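/- Let $F$ be a finite field with $q=|F|$, let $\lambda\in F^\times$ have multiplicative order $t=\operatorname{ord}(\lambda)$, and let $\alpha,\alpha'$ be positive integers with $\alpha\equiv\alpha' \pmod t$ and $\gcd(\alpha,t)=1$. For a positive integer $n$, a double $\lambda$-twisted code of ratio $\alpha'/\alpha$ over $F$, of cycle length $(\alpha' n,\alpha n)$, is an $F[X]$-submodule $C$ of $$\big(F[X]/\langle X^{\alpha' n}-\lambda\rangle\big)\times\big(F[X]/\langle X^{\alpha n}-\lambda\rangle\big),$$ regarded as a subset of $F^{\alpha' n+\alpha n}$ by identifying the pair of residue classes of $\sum_{j<\alpha' n}c'_jX^j$ and $\sum_{j<\alpha n}c_jX^j$ with the word $(c'_0,\dots,c'_{\alpha' n-1},c_0,\dots,c_{\alpha n-1})$. For a code $C\subseteq F^N$ with minimum Hamming distance $d(C)$, write $\mathrm{R}(C)=\frac{\log_q|C|}{N}$ for its rate and $\Delta(C)=\frac{d(C)}{N}$ for its relative minimum distance. Then the class of double $\lambda$-twisted codes of ratio $\alpha'/\alpha$ over $F$ is asymptotically good: there are positive integers $n_1,n_2,\dots$, double $\lambda$-twisted codes $C_i$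 of ratio $\alpha'/\alpha$ over $F$ of cycle length $(\alpha' n_i,\alpha n_i)$, and a real number $\delta>0$ such that the length $\alpha' n_i+\alpha n_i$ of $C_i$ tends to infinity as $i\to\infty$, and $\mathrm{R}(C_i)\ge\delta$ and $\Delta(C_i)\ge\delta$ for all $i\ge 1$. -/

import Mathlib

open Polynomial Filter

/-- A block code over the alphabet `F`: a length `n` together with a subset of `F ^ n`. -/
structure BlockCode (F : Type*) where
  /-- the code length `n` -/
  length : ℕ
  /-- the set of code words, a subset of `F ^ n` -/
  words : Set (Fin length → F)

namespace BlockCode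

variable {F : Type*}

open Classical in
/-- The minimum distance: the least Hamming distance between two distinct code words
(`0` if the code has fewer than two words). -/
noncomputable def minDist (C : BlockCode F) : ℕ :=
  sInf {d | ∃ u ∈ C.words, ∃ v ∈ C.words, u ≠ v ∧ hammingDist u v = d}

/-- The relative minimum distance `Δ(C) = d(C) / n`. -/
noncomputable def relMinDist (C : BlockCode F) : ℝ :=
  (C.minDist : ℝ) / (C.length : ℝ)

/-- The rate `R(C) = log_q |C| / n`, where `q = |F|`. -/
noncomputable def rate (C : BlockCode F) : ℝ :=
  Real.logb (Nat.card F : ℝ) (C.words.ncard : ℝ) / (C.length : ℝ)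

/-- A sequence of codes is asymptotically good if the lengths go to infinity and both the rates
and the relative minimum distances are bounded from below by a common positive real number. -/
def AsymptoticallyGoodSeq (C : ℕ → BlockCode F) : Prop :=
  Tendsto (fun i => (C i).length) atTop atTop ∧
    ∃ δ : ℝ, 0 < δ ∧ ∀ i, δ ≤ (C i).rate ∧ δ ≤ (C i).relMinDist

/-- A class of codes is asymptotically good if it contains an asymptotically good sequence. -/
def AsymptoticallyGood (S : Set (BlockCode F)) : Prop :=
  ∃ C : ℕ → BlockCode F, (∀ i, C i ∈ S) ∧ AsymptoticallyGoodSeq C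

end BlockCode

/-- The quotient `F[X] / ⟨X ^ m - lam⟩`, viewed as an `F[X]`-module. -/
abbrev ConstacyclicQuotient (F : Type*) [Field F] (lam : Fˣ) (m : ℕ) : Type _ :=
  F[X] ⧸ Ideal.span {(X ^ m - C (lam : F) : F[X])}

namespace ConstacyclicQuotient

variable {F : Type*} [Field F] {lam : Fˣ} {m : ℕ}

/-- The word `(c_0, …, c_{m-1})` of a residue class `c_0 + c_1 X + ⋯ + c_{m-1} X ^ (m-1)` modulo
`X ^ m - lam`: the coefficients of the remainder of any representative on division by
`X ^ m - lam`. -/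
noncomputable def word (x : ConstacyclicQuotient F lam m) : Fin m → F :=
  fun i => ((Quotient.out x : F[X]) %ₘ (X ^ m - C (lam : F))).coeff i

/-- The word does not depend on the representative. -/
theorem word_mk (hm : m ≠ 0) (f : F[X]) (i : Fin m) :
    word (Ideal.Quotient.mk (Ideal.span {(X ^ m - C (lam : F) : F[X])}) f) i
      = (f %ₘ (X ^ m - C (lam : F))).coeff i := by
  have hmon : (X ^ m - C (lam : F) : F[X]).Monic := monic_X_pow_sub_C _ hm
  have h : (X ^ m - C (lam : F) : F[X]) ∣
      (Quotient.out (Ideal.Quotient.mk (Ideal.span {(X ^ m - C (lam : F) : F[X])}) f) : F[X]) - f := by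
    rw [← Ideal.mem_span_singleton, ← Ideal.Quotient.eq]
    exact Quotient.out_eq _
  have h2 := (modByMonic_eq_zero_iff_dvd hmon).2 h
  rw [sub_modByMonic, sub_eq_zero] at h2
  simp only [word]
  rw [h2]

end ConstacyclicQuotient

/-- The code in `F ^ (m' + m)` given by an `F[X]`-submodule `D` of
`(F[X] / ⟨X ^ m' - lam⟩) × (F[X] / ⟨X ^ m - lam⟩)`: the set of all
`(c'_0, …, c'_{m'-1}, c_0, …, c_{m-1})` with `(c', c)` in `D`. -/
noncomputable def doubleConstacyclicCode {F : Type*} [Field F] {lam : Fˣ} {m' m : ℕ}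
    (D : Submodule F[X] (ConstacyclicQuotient F lam m' × ConstacyclicQuotient F lam m)) :
    BlockCode F where
  length := m' + m
  words := {w | ∃ c ∈ D, w = Fin.append c.1.word c.2.word}

/-- The class of double `lam`-twisted codes of ratio `a' / a` over `F`: all codes given by
`F[X]`-submodules of `(F[X] / ⟨X ^ (a' n) - lam⟩) × (F[X] / ⟨X ^ (a n) - lam⟩)`, for all `n > 0`. -/
def doubleTwistedCodes (F : Type*) [Field F] (lam : Fˣ) (a' a : ℕ) : Set (BlockCode F) :=
  {K | ∃ n : ℕ, 0 < n ∧
    ∃ D : Submodule F[X]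
        (ConstacyclicQuotient F lam (a' * n) × ConstacyclicQuotient F lam (a * n)),
      K = doubleConstacyclicCode D}

/-! The proof is a random-coding argument. If an irreducible `P` divides both `X ^ m' - lam` and `X
^ m - lam`, with cofactors `h'` and `h`, then the multiples of the pair of classes of `h'` and `u *
h` form a copy of the field `F[X]/P`. The `|F| ^ deg P` multipliers `u` modulo `P` give submodules
that pairwise meet only in zero (`dvd_sub_of_mem_pairSpan`). Hence, if the low-weight words are
fewer than that, some `u` avoids them all. The count (`exists_card_lowWeight_lt`) only needs `deg P`
to be at least a fixed fraction of the length, which also bounds the rate. Such `P` exist for `n = r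
^ k`, with `r` a fixed prime above `|F|`: a root of `P` generates a field containing a primitive `r
^ k`-th root of unity (`exists_common_irreducible_factor`), and lifting the exponent makes `deg P`
grow linearly in `r ^ k` (`exists_pow_le_mul_of_dvd_pow_sub_one`). -/

/-! ### Counting words of low weight -/

open Finset in
/-- The weight enumerator of the full space `F ^ N`. -/
theorem sum_pow_hammingNorm {F : Type*} [Field F] [Fintype F] [DecidableEq F] (N : ℕ) (z : ℝ) :
    ∑ x : Fin N → F, z ^ hammingNorm x = (1 + ((Fintype.card F : ℝ) - 1) * z) ^ N := by
  have h1 : ∀ x : Fin N → F, z ^ hammingNorm x = ∏ i, (if x i ≠ 0 then z else 1) := by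
    intro x
    rw [Finset.prod_ite]
    simp [hammingNorm]
  have h2 : ∑ y : F, (if y ≠ 0 then z else 1) = 1 + ((Fintype.card F : ℝ) - 1) * z := by
    rw [← Finset.add_sum_erase _ _ (mem_univ (0 : F))]
    rw [Finset.sum_congr rfl (g := fun _ => z)]
    · simp [Finset.card_erase_of_mem, Nat.cast_sub Fintype.card_pos]
    · intro y hy
      simp [(Finset.mem_erase.1 hy).1]
  calc ∑ x : Fin N → F, z ^ hammingNorm x
      = ∏ _i : Fin N, ∑ y : F, (if y ≠ 0 then z else 1) := by
        rw [Finset.prod_univ_sum, Fintype.piFinset_univ]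
        exact Finset.sum_congr rfl fun x _ => h1 x
    _ = _ := by rw [h2, Finset.prod_const, Finset.card_univ, Fintype.card_fin]

/-- For every `L > 0` there is an `M > 0` such that `F ^ N` has fewer than `|F| ^ d` words of
weight at most `N / M`, whenever `N ≤ L * d`. -/
theorem exists_card_lowWeight_lt (F : Type*) [Field F] [Fintype F] [DecidableEq F]
    {L : ℕ} (hL : 0 < L) :
    ∃ M : ℕ, 0 < M ∧ ∀ N d : ℕ, 0 < N → N ≤ L * d →
      (Finset.univ.filter fun x : Fin N → F => M * hammingNorm x ≤ N).card
        < Fintype.card F ^ d := by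
  set q : ℝ := (Fintype.card F : ℝ) with hq
  have hq1 : 1 < q := by
    rw [hq]; exact_mod_cast Fintype.one_lt_card
  -- The 2 leaves room for two factors `A ^ N`: one from weighting the words, one from the
  -- enumerator.
  set A : ℝ := q ^ ((1 : ℝ) / (2 * L)) with hA
  have hL' : (0 : ℝ) < L := by exact_mod_cast hL
  have hA1 : 1 < A := Real.one_lt_rpow hq1 (by positivity)
  have hApow : A ^ (2 * L) = q := by
    rw [hA, ← Real.rpow_natCast, ← Real.rpow_mul (by linarith)]
    push_cast
    rw [one_div, inv_mul_cancel₀ (by positivity), Real.rpow_one]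
  have hAq : A ≤ q := by
    rw [← hApow]
    exact le_self_pow₀ hA1.le (by omega)
  -- With this `z` the enumerator base `1 + (q - 1) * z` equals `A - z`, just below `A`.
  set z : ℝ := (A - 1) / q with hz
  have hz0 : 0 < z := div_pos (by linarith) (by linarith)
  have hz1 : z ≤ 1 := by
    rw [hz, div_le_one (by linarith)]; linarith
  have hzA : 1 + (q - 1) * z < A := by
    have : q * z = A - 1 := by rw [hz]; field_simp
    nlinarith
  obtain ⟨M, hM⟩ := pow_unbounded_of_one_lt z⁻¹ hA1
  refine ⟨M + 1, by omega, fun N d hN hNd => ?_⟩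
  have hM' : 1 ≤ A ^ (M + 1) * z := by
    have h1 : z⁻¹ ≤ A ^ (M + 1) := hM.le.trans (pow_le_pow_right₀ hA1.le (by omega))
    calc (1 : ℝ) = z⁻¹ * z := (inv_mul_cancel₀ hz0.ne').symm
      _ ≤ _ := by gcongr
  have hterm : ∀ x : Fin N → F, (M + 1) * hammingNorm x ≤ N →
      1 ≤ A ^ N * z ^ hammingNorm x := by
    intro x hx
    calc (1 : ℝ) ≤ (A ^ (M + 1) * z) ^ hammingNorm x := one_le_pow₀ hM'
      _ = A ^ ((M + 1) * hammingNorm x) * z ^ hammingNorm x := by rw [mul_pow, pow_mul]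
      _ ≤ _ := by gcongr; exact hA1.le
  have key : ((Finset.univ.filter fun x : Fin N → F => (M + 1) * hammingNorm x ≤ N).card : ℝ)
      < q ^ d := by
    calc ((Finset.univ.filter fun x : Fin N → F => (M + 1) * hammingNorm x ≤ N).card : ℝ)
        = ∑ x ∈ Finset.univ.filter (fun x : Fin N → F => (M + 1) * hammingNorm x ≤ N), (1 : ℝ) := by
          simp
      _ ≤ ∑ x ∈ Finset.univ.filter (fun x : Fin N → F => (M + 1) * hammingNorm x ≤ N),
            A ^ N * z ^ hammingNorm x :=
          Finset.sum_le_sum fun x hx => hterm x (Finset.mem_filter.1 hx).2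
      _ ≤ ∑ x : Fin N → F, A ^ N * z ^ hammingNorm x :=
          Finset.sum_le_sum_of_subset_of_nonneg (Finset.filter_subset _ _)
            fun _ _ _ => by positivity
      _ = A ^ N * (1 + (q - 1) * z) ^ N := by rw [← Finset.mul_sum, sum_pow_hammingNorm]
      _ < A ^ N * A ^ N := by
          have : 0 ≤ 1 + (q - 1) * z := by nlinarith
          gcongr
      _ = A ^ (2 * N) := by rw [two_mul, pow_add]
      _ ≤ A ^ (2 * L * d) := pow_le_pow_right₀ hA1.le (by nlinarith)
      _ = q ^ d := by rw [pow_mul, hApow]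
  rw [hq] at key
  exact_mod_cast key

/-! ### Words of residue classes, and multiples of a cofactor -/

namespace ConstacyclicQuotient

variable {F : Type*} [Field F] {lam : Fˣ} {m : ℕ}

theorem word_sub (hm : m ≠ 0) (x y : ConstacyclicQuotient F lam m) :
    (x - y).word = x.word - y.word := by
  obtain ⟨f, rfl⟩ := Ideal.Quotient.mk_surjective x
  obtain ⟨g, rfl⟩ := Ideal.Quotient.mk_surjective y
  ext i
  rw [← map_sub, Pi.sub_apply, word_mk hm, word_mk hm, word_mk hm, sub_modByMonic, coeff_sub]

theorem word_injective (hm : m ≠ 0) :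
    Function.Injective (word : ConstacyclicQuotient F lam m → Fin m → F) := by
  intro x y hxy
  rw [← sub_eq_zero]
  have h0 : (x - y).word = 0 := by rw [word_sub hm, hxy, sub_self]
  obtain ⟨f, hf⟩ := Ideal.Quotient.mk_surjective (x - y)
  rw [← hf] at h0 ⊢
  have hmon : (X ^ m - C (lam : F) : F[X]).Monic := monic_X_pow_sub_C _ hm
  rw [Ideal.Quotient.eq_zero_iff_mem, Ideal.mem_span_singleton,
    ← modByMonic_eq_zero_iff_dvd hmon]
  ext j
  by_cases hj : j < m
  · have := congrFun h0 ⟨j, hj⟩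
    rw [word_mk hm] at this
    simpa using this
  · rw [coeff_zero]
    apply coeff_eq_zero_of_degree_lt
    refine (degree_modByMonic_lt f hmon).trans_le ?_
    rw [degree_X_pow_sub_C (Nat.pos_of_ne_zero hm)]
    exact_mod_cast not_lt.1 hj

end ConstacyclicQuotient

/-- Two multiples of the cofactor of `P` in `X ^ m - lam` are congruent modulo `X ^ m - lam` iff
the multipliers are congruent modulo `P`. -/
theorem mk_mul_cofactor_eq_iff {F : Type*} [Field F] {lam : Fˣ} {m : ℕ} (hm : m ≠ 0)
    {P h : F[X]} (hP : P * h = X ^ m - C (lam : F)) (f g : F[X]) :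
    (Ideal.Quotient.mk (Ideal.span {(X ^ m - C (lam : F) : F[X])}) (f * h)
      = Ideal.Quotient.mk (Ideal.span {(X ^ m - C (lam : F) : F[X])}) (g * h)) ↔ P ∣ f - g := by
  have hne : (X ^ m - C (lam : F) : F[X]) ≠ 0 := (monic_X_pow_sub_C _ hm).ne_zero
  have hh : h ≠ 0 := by
    rintro rfl
    exact hne (by rw [← hP, mul_zero])
  rw [Ideal.Quotient.eq, Ideal.mem_span_singleton, ← hP, ← sub_mul, mul_dvd_mul_iff_right hh]

theorem natCard_degreeLT (F : Type*) [Field F] [Finite F] (d : ℕ) :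
    Nat.card (degreeLT F d) = Nat.card F ^ d := by
  rw [Nat.card_congr (degreeLTEquiv F d).toEquiv, Nat.card_fun, Nat.card_fin]

theorem eq_of_dvd_sub_of_mem_degreeLT {F : Type*} [Field F] {P : F[X]} {f g : F[X]}
    (hf : f ∈ degreeLT F P.natDegree) (hg : g ∈ degreeLT F P.natDegree) (h : P ∣ f - g) :
    f = g := by
  rcases eq_or_ne P 0 with rfl | hP
  · rwa [zero_dvd_iff, sub_eq_zero] at h
  · rw [← sub_eq_zero]
    apply eq_zero_of_dvd_of_degree_lt h
    rw [degree_eq_natDegree hP]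
    exact mem_degreeLT.1 (Submodule.sub_mem _ hf hg)

/-! ### Codes generated by one pair -/

section GeneratedCode

variable {F : Type*} [Field F] {lam : Fˣ} {m' m : ℕ}

/-- The submodule generated by the pair of residue classes of `h'` and `u * h`. -/
noncomputable def pairSpan (lam : Fˣ) (m' m : ℕ) (h' h u : F[X]) :
    Submodule F[X] (ConstacyclicQuotient F lam m' × ConstacyclicQuotient F lam m) :=
  Submodule.span F[X] {(Ideal.Quotient.mk _ h', Ideal.Quotient.mk _ (u * h))}

theorem mem_pairSpan {h' h u : F[X]}
    {c : ConstacyclicQuotient F lam m' × ConstacyclicQuotient F lam m} :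
    c ∈ pairSpan lam m' m h' h u ↔
      ∃ f : F[X], c = (Ideal.Quotient.mk _ (f * h'), Ideal.Quotient.mk _ (f * u * h)) := by
  rw [pairSpan, Submodule.mem_span_singleton]
  constructor
  · rintro ⟨f, rfl⟩
    exact ⟨f, by rw [mul_assoc]; rfl⟩
  · rintro ⟨f, rfl⟩
    exact ⟨f, by rw [mul_assoc]; rfl⟩

/-- The word of length `m' + m` of a pair of residue classes. -/
noncomputable def pairWord (c : ConstacyclicQuotient F lam m' × ConstacyclicQuotient F lam m) :
    Fin (m' + m) → F :=
  Fin.append c.1.word c.2.word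

theorem pairWord_injective (hm' : m' ≠ 0) (hm : m ≠ 0) :
    Function.Injective (pairWord (F := F) (lam := lam) (m' := m') (m := m)) := by
  intro x y hxy
  have h1 : x.1.word = y.1.word := by
    ext i
    simpa [pairWord] using congrFun hxy (Fin.castAdd m i)
  have h2 : x.2.word = y.2.word := by
    ext i
    simpa [pairWord] using congrFun hxy (Fin.natAdd m' i)
  exact Prod.ext (ConstacyclicQuotient.word_injective hm' h1)
    (ConstacyclicQuotient.word_injective hm h2)

theorem pairWord_sub (hm' : m' ≠ 0) (hm : m ≠ 0)
    (x y : ConstacyclicQuotient F lam m' × ConstacyclicQuotient F lam m) :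
    pairWord (x - y) = pairWord x - pairWord y := by
  ext i
  refine Fin.addCases (fun i => ?_) (fun i => ?_) i
  · simp [pairWord, ConstacyclicQuotient.word_sub hm']
  · simp [pairWord, ConstacyclicQuotient.word_sub hm]

variable {P h' h : F[X]}

/-- A nonzero pair lies in at most one of the submodules `pairSpan lam m' m h' h u`, up to
congruence of `u` modulo `P`. -/
theorem dvd_sub_of_mem_pairSpan (hm' : m' ≠ 0) (hm : m ≠ 0) (hP : Irreducible P)
    (hh' : P * h' = X ^ m' - C (lam : F)) (hh : P * h = X ^ m - C (lam : F)) {u v : F[X]}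
    {c : ConstacyclicQuotient F lam m' × ConstacyclicQuotient F lam m} (hc : c ≠ 0)
    (hu : c ∈ pairSpan lam m' m h' h u) (hv : c ∈ pairSpan lam m' m h' h v) : P ∣ u - v := by
  obtain ⟨f, hf⟩ := mem_pairSpan.1 hu
  obtain ⟨g, hg⟩ := mem_pairSpan.1 hv
  rw [hf, Prod.mk.injEq, mk_mul_cofactor_eq_iff hm' hh', mk_mul_cofactor_eq_iff hm hh] at hg
  have hPf : ¬ P ∣ f := by
    rintro ⟨k, rfl⟩
    apply hc
    rw [hf, Prod.mk_eq_zero, Ideal.Quotient.eq_zero_iff_mem, Ideal.Quotient.eq_zero_iff_mem,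
      Ideal.mem_span_singleton, Ideal.mem_span_singleton, ← hh', ← hh]
    exact ⟨⟨k, by ring⟩, ⟨k * u, by ring⟩⟩
  have h3 : P ∣ f * (u - v) := by
    have : f * (u - v) = (f * u - g * v) - (f - g) * v := by ring
    rw [this]
    exact dvd_sub hg.2 (hg.1.mul_right v)
  exact (hP.prime.dvd_or_dvd h3).resolve_left hPf

/-- The first components `f * h'` with `deg f < deg P` are already distinct, so the bound is uniform
in `u`. -/
theorem card_pow_natDegree_le_ncard_words [Finite F] (hm' : m' ≠ 0) (hm : m ≠ 0)
    (hh' : P * h' = X ^ m' - C (lam : F)) (u : F[X]) :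
    Nat.card F ^ P.natDegree ≤
      (doubleConstacyclicCode (pairSpan lam m' m h' h u)).words.ncard := by
  rw [← natCard_degreeLT, ← Nat.card_coe_set_eq]
  have : Finite (doubleConstacyclicCode (pairSpan lam m' m h' h u)).words :=
    inferInstanceAs (Finite (Set.Elem (α := Fin (m' + m) → F) _))
  refine Nat.card_le_card_of_injective
    (fun f : degreeLT F P.natDegree => (⟨pairWord (lam := lam)
      (Ideal.Quotient.mk _ ((f : F[X]) * h'), Ideal.Quotient.mk _ ((f : F[X]) * u * h)),
      _, mem_pairSpan.2 ⟨f, rfl⟩, rfl⟩ :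
        (doubleConstacyclicCode (pairSpan lam m' m h' h u)).words)) ?_
  intro f g hfg
  have h1 := pairWord_injective hm' hm (Subtype.ext_iff.1 hfg)
  rw [Prod.mk.injEq, mk_mul_cofactor_eq_iff hm' hh'] at h1
  exact Subtype.ext (eq_of_dvd_sub_of_mem_degreeLT f.2 g.2 h1.1)

/-- If `P` is an irreducible common factor of `X ^ m' - lam` and `X ^ m - lam` and there are fewer
than `|F| ^ deg P` words of weight at most `(m' + m) / M`, then some submodule generated by a pair
has all its nonzero weights above that bound. -/
theorem exists_pairSpan_weight_lt [Fintype F] [DecidableEq F] (hm' : m' ≠ 0) (hm : m ≠ 0)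
    (hP : Irreducible P)
    (hh' : P * h' = X ^ m' - C (lam : F)) (hh : P * h = X ^ m - C (lam : F)) {M : ℕ}
    (hcard : (Finset.univ.filter fun x : Fin (m' + m) → F => M * hammingNorm x ≤ m' + m).card
        < Fintype.card F ^ P.natDegree) :
    ∃ u : F[X], ∀ c ∈ pairSpan lam m' m h' h u, c ≠ 0 →
      m' + m < M * hammingNorm (pairWord c) := by
  -- Otherwise every `u` has a bad nonzero pair, and these are distinct for distinct `u` of degree
  -- below `deg P`.
  by_contra! hbad
  choose c hc hc0 hcw using hbad
  refine hcard.not_ge ?_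
  rw [← Nat.card_eq_fintype_card, ← natCard_degreeLT, ← Nat.subtype_card
    (p := fun x : Fin (m' + m) → F => M * hammingNorm x ≤ m' + m) _ (fun x => by simp)]
  refine Nat.card_le_card_of_injective
    (fun u : degreeLT F P.natDegree =>
      (⟨pairWord (c u), hcw u⟩ : {x : Fin (m' + m) → F // M * hammingNorm x ≤ m' + m})) ?_
  intro u v huv
  have h1 := pairWord_injective hm' hm (Subtype.ext_iff.1 huv)
  exact Subtype.ext (eq_of_dvd_sub_of_mem_degreeLT u.2 v.2
    (dvd_sub_of_mem_pairSpan hm' hm hP hh' hh (hc0 u) (hc u) (h1 ▸ hc v)))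

end GeneratedCode

/-! ### Common irreducible factors of large degree -/

/-- The multiplicative order of `q` modulo `r ^ k` is bounded below by a constant times `r ^ k`,
for an odd prime `r` not dividing `q`. -/
theorem exists_pow_le_mul_of_dvd_pow_sub_one {r q : ℕ} (hr : r.Prime) (hodd : Odd r) (hq : 1 < q)
    (hrq : ¬ r ∣ q) :
    ∃ s : ℕ, 0 < s ∧ ∀ k d : ℕ, 0 < d → r ^ k ∣ q ^ d - 1 → r ^ k ≤ s * d := by
  have : Fact r.Prime := ⟨hr⟩
  -- By Fermat `r` divides `Q - 1`, as lifting the exponent requires.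
  set Q := q ^ (r - 1) with hQ
  have hr2 := hr.two_le
  have hQ1 : 1 < Q := Nat.one_lt_pow (by omega) hq
  have hdvd : r ∣ Q - 1 := by
    have h := Nat.ModEq.pow_totient ((Nat.Prime.coprime_iff_not_dvd hr).2 hrq).symm
    rw [Nat.totient_prime hr] at h
    exact (Nat.modEq_iff_dvd' hQ1.le).1 h.symm
  have hrQ : ¬ r ∣ Q := fun h => hrq (hr.dvd_of_dvd_pow h)
  refine ⟨r ^ padicValNat r (Q - 1), pow_pos hr.pos _, fun k d hd hk => ?_⟩
  have h1 : r ^ k ∣ Q ^ d - 1 := by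
    refine hk.trans ?_
    rw [hQ, ← pow_mul, mul_comm, pow_mul]
    simpa using Nat.sub_dvd_pow_sub_pow (q ^ d) 1 (r - 1)
  have h2 := padicValNat.pow_sub_pow (p := r) hodd hQ1 hdvd hrQ hd.ne'
  rw [one_pow] at h2
  have hne : Q ^ d - 1 ≠ 0 := by
    have := Nat.one_lt_pow hd.ne' hQ1
    omega
  have h3 : k ≤ padicValNat r (Q ^ d - 1) := (padicValNat_dvd_iff_le hne).1 h1
  calc r ^ k ≤ r ^ (padicValNat r (Q - 1) + padicValNat r d) :=
        Nat.pow_le_pow_right hr.pos (h2 ▸ h3)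
    _ = r ^ padicValNat r (Q - 1) * r ^ padicValNat r d := pow_add _ _ _
    _ ≤ _ := Nat.mul_le_mul_left _ (Nat.le_of_dvd hd pow_padicValNat_dvd)

/-- If `r` is a prime exceeding `|F|`, then for every `k` the polynomials
`X ^ (a' * r ^ k) - lam` and `X ^ (a * r ^ k) - lam` have a common irreducible factor, of degree
`d` such that `r ^ k` divides `|F| ^ d - 1`. -/
theorem exists_common_irreducible_factor (F : Type*) [Field F] [Finite F] (lam : Fˣ) {a a' : ℕ}
    (hmod : a ≡ a' [MOD orderOf lam]) (hgcd : Nat.gcd a (orderOf lam) = 1)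
    {r : ℕ} (hr : r.Prime) (hrF : Nat.card F < r) (k : ℕ) :
    ∃ P : F[X], Irreducible P ∧ P ∣ X ^ (a' * r ^ k) - C (lam : F) ∧
      P ∣ X ^ (a * r ^ k) - C (lam : F) ∧ r ^ k ∣ Nat.card F ^ P.natDegree - 1 := by
  have := Fintype.ofFinite F
  let K := AlgebraicClosure F
  have hrF' : (r : F) ≠ 0 := by
    obtain ⟨p, hp⟩ := CharP.exists F
    rw [Ne, CharP.cast_eq_zero_iff F p]
    have hpp : p.Prime := CharP.char_prime_of_ne_zero F (CharP.char_ne_zero_of_finite F p)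
    intro h
    have hpr : p = r := (Nat.prime_dvd_prime_iff_eq hpp hr).1 h
    have hpF : p ∣ Fintype.card F := (CharP.cast_eq_zero_iff F p _).1 (Nat.cast_card_eq_zero F)
    have := Nat.le_of_dvd Fintype.card_pos hpF
    rw [Nat.card_eq_fintype_card] at hrF
    omega
  have : NeZero (r : F) := ⟨hrF'⟩
  obtain ⟨ζ, hζ⟩ := HasEnoughRootsOfUnity.exists_primitiveRoot K (r ^ k)
  have hord : orderOf lam < r := by
    have h1 : orderOf lam ≤ Nat.card Fˣ := orderOf_le_card
    have h2 : Nat.card Fˣ ≤ Nat.card F := Nat.card_le_card_of_injective _ Units.val_injective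
    omega
  have hcop : Nat.Coprime (a * r ^ k) (orderOf lam) := by
    refine Nat.Coprime.mul_left hgcd (Nat.Coprime.pow_left k ?_)
    exact hr.coprime_iff_not_dvd.2 (Nat.not_dvd_of_pos_of_lt (orderOf_pos lam) hord)
  -- Raising to the power `a * r ^ k` permutes the powers of `lam`; `s` inverts it, so `lam ^ s` is
  -- a root in `F` of both polynomials.
  obtain ⟨s, hs⟩ := exists_pow_eq_self_of_coprime hcop
  have hs' : (lam ^ (a' * r ^ k)) ^ s = lam := by
    have h1 : lam ^ (a' * r ^ k) = lam ^ (a * r ^ k) :=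
      pow_eq_pow_iff_modEq.2 (hmod.symm.mul_right _)
    rw [h1, hs]
  set c : F := ((lam ^ s : Fˣ) : F) with hc
  have hc0 : c ≠ 0 := Units.ne_zero _
  -- Twisting the root `c` by `ζ` keeps it a common root and forces `F(β)` to contain `ζ`.
  set β : K := algebraMap F K c * ζ with hβ
  have hβint : IsIntegral F β := Algebra.IsIntegral.isIntegral β
  have hroot : ∀ b : ℕ, (lam ^ (b * r ^ k)) ^ s = lam →
      minpoly F β ∣ X ^ (b * r ^ k) - C (lam : F) := by
    intro b hb
    have hcb : c ^ (b * r ^ k) = (lam : F) := by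
      rw [hc, ← Units.val_pow_eq_pow_val, ← pow_mul, mul_comm s, pow_mul, hb]
    have hζb : ζ ^ (b * r ^ k) = 1 := by rw [mul_comm, pow_mul, hζ.pow_eq_one, one_pow]
    apply minpoly.dvd
    rw [map_sub, map_pow, aeval_X, aeval_C, hβ, mul_pow, hζb, ← map_pow, hcb, mul_one, sub_self]
  refine ⟨minpoly F β, minpoly.irreducible hβint, hroot a' hs', hroot a hs, ?_⟩
  have : FiniteDimensional F (IntermediateField.adjoin F {β}) :=
    IntermediateField.adjoin.finiteDimensional hβint
  have : Finite (IntermediateField.adjoin F {β}) := Module.finite_of_finite F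
  have := Fintype.ofFinite (IntermediateField.adjoin F {β})
  rw [← IntermediateField.adjoin.finrank hβint, ← Module.natCard_eq_pow_finrank,
    Nat.card_eq_fintype_card]
  have hmem : ζ ∈ IntermediateField.adjoin F {β} := by
    have h1 : ζ = algebraMap F K c⁻¹ * β := by
      rw [hβ, ← mul_assoc, ← map_mul, inv_mul_cancel₀ hc0, map_one, one_mul]
    rw [h1]
    exact mul_mem (algebraMap_mem _ _) (IntermediateField.mem_adjoin_simple_self F β)
  have hζ0 : ζ ≠ 0 := hζ.ne_zero (pow_pos hr.pos k).ne'
  apply hζ.dvd_of_pow_eq_one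
  have h2 := FiniteField.pow_card_sub_one_eq_one (⟨ζ, hmem⟩ : IntermediateField.adjoin F {β})
    (fun h => hζ0 (congrArg Subtype.val h))
  exact congrArg Subtype.val h2

/-! ### Rate and distance bounds, and the final sequence -/

open Classical in
/-- A lower bound for the nonzero weights is a lower bound for the minimum distance. -/
theorem le_minDist_of_pairWord {F : Type*} [Field F] {lam : Fˣ} {m' m w : ℕ}
    (hm' : m' ≠ 0) (hm : m ≠ 0)
    {D : Submodule F[X] (ConstacyclicQuotient F lam m' × ConstacyclicQuotient F lam m)}
    (hD : (doubleConstacyclicCode D).words.Nontrivial)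
    (hw : ∀ c ∈ D, c ≠ 0 → w ≤ hammingNorm (pairWord c)) :
    w ≤ (doubleConstacyclicCode D).minDist := by
  obtain ⟨u, hu, v, hv, huv⟩ := hD
  refine le_csInf ⟨_, u, hu, v, hv, huv, rfl⟩ ?_
  rintro _ ⟨_, ⟨c, hc, rfl⟩, _, ⟨e, he, rfl⟩, hne, rfl⟩
  have h1 := hw (e - c) (D.sub_mem he hc) (fun h => hne (by rw [sub_eq_zero.1 h]))
  rw [pairWord_sub hm' hm, ← neg_add_eq_sub, ← hammingDist_eq_hammingNorm] at h1
  exact h1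

/-- A good double twisted code from a common irreducible factor of large degree. -/
theorem exists_pairSpan_good {F : Type*} [Field F] [Finite F] {lam : Fˣ} {L : ℕ} (hL : 0 < L) :
    ∃ δ : ℝ, 0 < δ ∧ ∀ {m' m : ℕ} {P : F[X]}, m' ≠ 0 → m ≠ 0 → Irreducible P →
      P ∣ X ^ m' - C (lam : F) → P ∣ X ^ m - C (lam : F) → m' + m ≤ L * P.natDegree →
      ∃ D : Submodule F[X] (ConstacyclicQuotient F lam m' × ConstacyclicQuotient F lam m),
        δ ≤ (doubleConstacyclicCode D).rate ∧ δ ≤ (doubleConstacyclicCode D).relMinDist := by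
  classical
  have := Fintype.ofFinite F
  obtain ⟨M, hM, hcount⟩ := exists_card_lowWeight_lt F hL
  have hL' : (0 : ℝ) < L := by exact_mod_cast hL
  have hM' : (0 : ℝ) < M := by exact_mod_cast hM
  refine ⟨min (1 / (L : ℝ)) (1 / (M : ℝ)), by positivity, ?_⟩
  rintro m' m P hm' hm hP ⟨h', hh'⟩ ⟨h, hh⟩ hdeg
  obtain ⟨u, hu⟩ := exists_pairSpan_weight_lt hm' hm hP hh'.symm hh.symm
    (hcount _ _ (by omega) hdeg)
  have hN : (0 : ℝ) < ((m' + m : ℕ) : ℝ) := by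
    exact_mod_cast (by omega : 0 < m' + m)
  have hcard := card_pow_natDegree_le_ncard_words hm' hm hh'.symm (h := h) u
  have hq : 1 < Nat.card F := Finite.one_lt_card
  refine ⟨pairSpan lam m' m h' h u, (min_le_left _ _).trans ?_, (min_le_right _ _).trans ?_⟩
  · refine (div_le_div_iff₀ hL' hN).2 ?_
    rw [one_mul]
    have h1 : (P.natDegree : ℝ) ≤ Real.logb (Nat.card F : ℝ)
        ((doubleConstacyclicCode (pairSpan lam m' m h' h u)).words.ncard : ℝ) := by
      have hpos : 0 < Nat.card F ^ P.natDegree := pow_pos (by omega) _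
      rw [Real.le_logb_iff_rpow_le (by exact_mod_cast hq)
        (by exact_mod_cast hpos.trans_le hcard), Real.rpow_natCast]
      exact_mod_cast hcard
    calc ((m' + m : ℕ) : ℝ) ≤ ((L * P.natDegree : ℕ) : ℝ) := by exact_mod_cast hdeg
      _ = P.natDegree * L := by push_cast; ring
      _ ≤ _ := by gcongr
  · refine (div_le_div_iff₀ hM' hN).2 ?_
    rw [one_mul]
    have hnt : (doubleConstacyclicCode (pairSpan lam m' m h' h u)).words.Nontrivial := by
      apply Set.one_lt_ncard_iff_nontrivial.1
      exact (Nat.one_lt_pow hP.natDegree_pos.ne' hq).trans_le hcard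
    -- The `+ 1`, available because the weight bound is strict, absorbs the rounding in the
    -- division.
    have h1 : (m' + m) / M + 1 ≤
        (doubleConstacyclicCode (pairSpan lam m' m h' h u)).minDist := by
      refine le_minDist_of_pairWord hm' hm hnt fun c hc hc0 => ?_
      exact Nat.succ_le_of_lt (Nat.div_lt_of_lt_mul (hu c hc hc0))
    have h2 : m' + m ≤
        (doubleConstacyclicCode (pairSpan lam m' m h' h u)).minDist * M := by
      calc m' + m ≤ ((m' + m) / M + 1) * M := by
            rw [mul_comm]
            exact (Nat.lt_mul_div_succ _ hM).le
        _ ≤ _ := Nat.mul_le_mul_right _ h1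
    exact_mod_cast h2

theorem corollary1p2 (F : Type*) [Field F] [Finite F] (lam : Fˣ) (a a' : ℕ)
    (ha : 0 < a) (ha' : 0 < a') (hmod : a ≡ a' [MOD orderOf lam])
    (hgcd : Nat.gcd a (orderOf lam) = 1) :
    BlockCode.AsymptoticallyGood (doubleTwistedCodes F lam a' a) := by
  -- A prime above `|F|` is odd and divides neither `|F|` nor the order of `lam`.
  obtain ⟨r, hrF, hr⟩ := Nat.exists_infinite_primes (Nat.card F + 1)
  have hq : 1 < Nat.card F := Finite.one_lt_card
  obtain ⟨s, hs, hsr⟩ := exists_pow_le_mul_of_dvd_pow_sub_one hr (hr.odd_of_ne_two (by omega)) hq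
    (Nat.not_dvd_of_pos_of_lt (by omega) (by omega))
  obtain ⟨δ, hδ, hgood⟩ := exists_pairSpan_good (F := F) (lam := lam)
    (L := (a' + a) * s) (by positivity)
  have hrk : ∀ k, 0 < r ^ k := fun k => pow_pos hr.pos k
  have hex : ∀ k : ℕ, ∃ D : Submodule F[X]
      (ConstacyclicQuotient F lam (a' * r ^ k) × ConstacyclicQuotient F lam (a * r ^ k)),
      δ ≤ (doubleConstacyclicCode D).rate ∧ δ ≤ (doubleConstacyclicCode D).relMinDist := by
    intro k
    obtain ⟨P, hP, hPa', hPa, hdvd⟩ :=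
      exists_common_irreducible_factor F lam hmod hgcd hr (by omega) k
    refine hgood (mul_pos ha' (hrk k)).ne' (mul_pos ha (hrk k)).ne' hP hPa' hPa ?_
    calc a' * r ^ k + a * r ^ k = (a' + a) * r ^ k := by ring
      _ ≤ (a' + a) * (s * P.natDegree) := Nat.mul_le_mul_left _ (hsr k _ hP.natDegree_pos hdvd)
      _ = _ := by ring
  choose D hD using hex
  refine ⟨fun k => doubleConstacyclicCode (D k), fun k => ⟨r ^ k, hrk k, D k, rfl⟩, ?_, δ, hδ, hD⟩
  refine tendsto_atTop_mono (fun k => ?_) tendsto_id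
  change k ≤ a' * r ^ k + a * r ^ k
  have h1 : k < r ^ k := Nat.lt_pow_self hr.one_lt
  have h2 : r ^ k ≤ a * r ^ k := Nat.le_mul_of_pos_left _ ha
  omega
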